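/- Let $A=\langle a,b\mid\rangle$ be the free group on $a,b$, let $m\ge 0$ and $s\ge 10$ be integers, and let $k_{ij}^{(t)}$ ($1\le i\le m$, $1\le j\le s$, $t\in\{1,2\}$) be nonzero integers such that the two sets $$\{|k_{ij}^{(1)}| : 1\le i\le m,\ 1\le j\le s\}\cup\{|k_{i1}^{(1)}-k_{i'1}^{(1)}| : 1\le i<i'\le m\},$$ $$\{|k_{ij}^{(2)}| : 1\le i\le m,\ 1\le j\le s\}\cup\{|k_{is}^{(2)}-k_{i's}^{(2)}| : 1\le i<i'\le m\}$$ both have cardinality $sm+\binom m2$. Let $C$ be the subgroup of $A$ generated by the elements $$\alpha_i=a^{k_{i1}^{(1)}}b^{k_{i1}^{(2)}}a^{k_{i2}^{(1)}}b^{k_{i2}^{(2)}}\cdots a^{k_{is}^{(1)}}b^{k_{is}^{(2)}},\qquad 1\le i\le m.$$ Then $C$ is relatively torsion-free in $A$: for all $g\in A\setminus C$, all $n\ge 1$ and all $h_1,\dots,h_n\in C$, $$g h_1 g h_2\cdots g h_n\ne 1.$$ -/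

import Mathlib

/-- A subgroup `H` of `G` is relatively torsion-free if `g h₁ g h₂ ⋯ g hₖ ≠ 1` for every `g ∉ H`
and every nonempty finite sequence `h₁, …, hₖ` of elements of `H`. -/
def IsRelativelyTorsionFree {G : Type*} [Group G] (H : Subgroup G) : Prop :=
  ∀ g : G, g ∉ H → ∀ (n : ℕ) (h : Fin n → G), 1 ≤ n → (∀ i, h i ∈ H) →
    (List.ofFn fun i => g * h i).prod ≠ 1

/-- The element `a ^ k(i,1,1) * b ^ k(i,1,2) * ⋯ * a ^ k(i,s,1) * b ^ k(i,s,2)` of the free group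
on `a = of 0` and `b = of 1`. -/
def alphaWord {m s : ℕ} (k : Fin m → Fin s → Fin 2 → ℤ) (i : Fin m) : FreeGroup (Fin 2) :=
  (List.ofFn fun j : Fin s => FreeGroup.of 0 ^ k i j 0 * FreeGroup.of 1 ^ k i j 1).prod

/-- The subgroup `C` of the free group of rank two generated by the words `α₁, …, αₘ`. -/
def subgroupC {m s : ℕ} (k : Fin m → Fin s → Fin 2 → ℤ) : Subgroup (FreeGroup (Fin 2)) :=
  Subgroup.closure (Set.range (alphaWord k))

/-- The set `{|e i j|} ∪ {|e i j₀ - e i' j₀| : i < i'}` of absolute values. -/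
def exponentSet {m s : ℕ} (e : Fin m → Fin s → ℤ) (j₀ : Fin s) : Set ℤ :=
  {x | ∃ i j, x = |e i j|} ∪ {x | ∃ i i', i < i' ∧ x = |e i j₀ - e i' j₀|}

/-- The distinctness condition on the exponents: the exponents of `a` with the differences of first
exponents, and likewise the exponents of `b` with the differences of last exponents, yield the
largest possible number `s m + (m choose 2)` of absolute values. -/
def DistinctExponents {m s : ℕ} (hs : 0 < s) (k : Fin m → Fin s → Fin 2 → ℤ) : Prop :=
  (exponentSet (fun i j => k i j 0) ⟨0, hs⟩).ncard = s * m + m.choose 2 ∧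
  (exponentSet (fun i j => k i j 1) ⟨s - 1, Nat.sub_lt hs Nat.one_pos⟩).ncard
    = s * m + m.choose 2

/-! For `g ∉ C` it suffices to find an action of the free group with distinct points `v n`, `n ∈ ℤ`,
such that `C` fixes every `v n` and `g` sends `v n` to `v (n + 1)`: then `g h₁ ⋯ g hₙ` moves `v 0`
to `v n`, so it is not `1`.

Such actions come from folded graphs, whose partial bijections extend to permutations. Take `ℤ`
copies (levels) of the Stallings graph of `C`, in which the `αᵢ` are loops at a base vertex. Read as
much of the reduced word of `g` as possible from the base at both ends, leaving a shortest unread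
middle part, to be read from `y` to `x`. If it is nonempty, it can be glued in as an arc from `y` on
each level to `x` on the next without any folding (`exists_levelMap_of_word`). If it is empty and `x
= y`, then `g` labels a closed path at the base and lies in `C` (`exists_cosetMap`). If it is empty
and `x ≠ y`, then `y` on each level has to be identified with `x` on the next, and the folding this
forces must not merge levels of the base (`canShift_of_isSidon`).

The exponents enter only in this last case. The graph consists of `a`-lines and `b`-lines crossing
at junctions. Distinctness of the absolute values says that a difference of positions on a line
determines the two junctions (`isSidon_junctionPosition`), so superposing lines creates almost no
new coincidences of junctions and the folding stops at once. -/

/-! ### Folded labelled graphs and actions of free groups. -/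

/-- A family of relations, read as the labelled edges of a graph, is folded if no two edges with the
same label share their source or their target. -/
def IsFolded {α V : Type} (E : α → V → V → Prop) : Prop := ∀ t, Relator.BiUnique (E t)

/-- One step along an edge, backwards if the letter is inverted. -/
def StepAlong {α V : Type} (E : α → V → V → Prop) (x : α × Bool) (u v : V) : Prop :=
  if x.2 then E x.1 u v else E x.1 v u

/-- The word `L`, read from right to left, leads from the first vertex to the second one. -/
def LeadsTo {α V : Type} (E : α → V → V → Prop) : List (α × Bool) → V → V → Prop
  | [], u, v => u = v
  | x :: L, u, v => ∃ w, LeadsTo E L u w ∧ StepAlong E x w v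

/-- A compatible map from `ℤ` copies of a labelled graph to an action of the free group. -/
structure LevelMap {α V : Type} (E : α → V → V → Prop) (Y : Type) where
  /-- The action of the free group. -/
  act : FreeGroup α →* Equiv.Perm Y
  /-- The map on vertices and levels. -/
  toFun : V → ℤ → Y
  map_edge : ∀ t u v n, E t u v → act (FreeGroup.of t) (toFun u n) = toFun v n

/-- Identifying `y` on each level with `x` on the next level does not identify any two levels
of `v₀`. -/
def CanShift {α V : Type} (E : α → V → V → Prop) (v₀ x y : V) : Prop :=
  ∃ (Y : Type) (f : LevelMap E Y), Function.Injective (f.toFun v₀) ∧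
    ∀ n, f.toFun y n = f.toFun x (n + 1)

/-- The second copy of `V` carries the inverse of the partial bijection. A vertex without an image
crosses over to its twin in the second copy, and a twin without an image there crosses back. -/
theorem exists_perm_extending {V : Type} {r : V → V → Prop} (hr : Relator.BiUnique r) :
    ∃ σ : Equiv.Perm (V ⊕ V), ∀ u v, r u v → σ (Sum.inl u) = Sum.inl v := by
  classical
  have hL : ∀ u v (h : ∃ w, r w v), r u v → h.choose = u := fun u v h huv =>
    hr.1 h.choose_spec huv
  have hR : ∀ u v (h : ∃ w, r u w), r u v → h.choose = v := fun u v h huv =>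
    hr.2 h.choose_spec huv
  refine ⟨⟨Sum.elim (fun u => if h : ∃ v, r u v then Sum.inl h.choose else Sum.inr u)
      (fun v => if h : ∃ u, r u v then Sum.inr h.choose else Sum.inl v),
    Sum.elim (fun v => if h : ∃ u, r u v then Sum.inl h.choose else Sum.inr v)
      (fun u => if h : ∃ v, r u v then Sum.inr h.choose else Sum.inl u), ?_, ?_⟩, ?_⟩
  · rintro (u | v)
    · by_cases h : ∃ v, r u v
      · have h' : ∃ w, r w h.choose := ⟨u, h.choose_spec⟩
        simp only [Sum.elim_inl, dif_pos h, dif_pos h', hL u _ h' h.choose_spec]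
      · simp [h]
    · by_cases h : ∃ u, r u v
      · have h' : ∃ w, r h.choose w := ⟨v, h.choose_spec⟩
        simp only [Sum.elim_inr, dif_pos h, dif_pos h', hR _ v h' h.choose_spec]
      · simp [h]
  · rintro (v | u)
    · by_cases h : ∃ u, r u v
      · have h' : ∃ w, r h.choose w := ⟨v, h.choose_spec⟩
        simp only [Sum.elim_inl, dif_pos h, dif_pos h', hR _ v h' h.choose_spec]
      · simp [h]
    · by_cases h : ∃ v, r u v
      · have h' : ∃ w, r w h.choose := ⟨u, h.choose_spec⟩
        simp only [Sum.elim_inr, dif_pos h, dif_pos h', hL u _ h' h.choose_spec]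
      · simp [h]
  · intro u v huv
    have h : ∃ v, r u v := ⟨v, huv⟩
    simp only [Equiv.coe_fn_mk, Sum.elim_inl, dif_pos h, hR u v h huv]

theorem IsFolded.exists_action {α V : Type} {E : α → V → V → Prop} (hE : IsFolded E) :
    ∃ ρ : FreeGroup α →* Equiv.Perm (V ⊕ V),
      ∀ t u v, E t u v → ρ (FreeGroup.of t) (Sum.inl u) = Sum.inl v := by
  choose σ hσ using fun t => exists_perm_extending (hE t)
  exact ⟨FreeGroup.lift σ, fun t u v h => by simpa using hσ t u v h⟩

/-- A map of `ℤ` copies of a labelled graph to a folded graph gives a compatible map to an action. -/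
theorem IsFolded.exists_levelMap {α V W : Type} {E : α → V → V → Prop} {E' : α → W → W → Prop}
    (hE' : IsFolded E') (φ : V → ℤ → W) (hφ : ∀ t u v n, E t u v → E' t (φ u n) (φ v n)) :
    ∃ (ρ : FreeGroup α →* Equiv.Perm (W ⊕ W)) (f : LevelMap E (W ⊕ W)), f.act = ρ ∧
      (∀ u n, f.toFun u n = Sum.inl (φ u n)) ∧
      ∀ t u v, E' t u v → ρ (FreeGroup.of t) (Sum.inl u) = Sum.inl v := by
  obtain ⟨ρ, hρ⟩ := hE'.exists_action
  exact ⟨ρ, ⟨ρ, fun u n => Sum.inl (φ u n), fun t u v n h => hρ _ _ _ (hφ t u v n h)⟩, rfl,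
    fun _ _ => rfl, hρ⟩

theorem act_mk_cons {α Y : Type} (ρ : FreeGroup α →* Equiv.Perm Y) (x : α × Bool)
    (L : List (α × Bool)) (p : Y) :
    ρ (FreeGroup.mk (x :: L)) p = ρ (FreeGroup.mk [x]) (ρ (FreeGroup.mk L) p) := by
  rw [← Equiv.Perm.mul_apply, ← map_mul, FreeGroup.mul_mk, List.singleton_append]

theorem act_mk_append {α Y : Type} (ρ : FreeGroup α →* Equiv.Perm Y)
    (L M : List (α × Bool)) (p : Y) :
    ρ (FreeGroup.mk (L ++ M)) p = ρ (FreeGroup.mk L) (ρ (FreeGroup.mk M) p) := by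
  rw [← Equiv.Perm.mul_apply, ← map_mul, FreeGroup.mul_mk]

theorem act_mk_of_stepAlong {α Y V : Type} {E : α → V → V → Prop} {ρ : FreeGroup α →* Equiv.Perm Y}
    {φ : V → Y} (h : ∀ t u v, E t u v → ρ (FreeGroup.of t) (φ u) = φ v) {x : α × Bool} {u v : V}
    (hs : StepAlong E x u v) : ρ (FreeGroup.mk [x]) (φ u) = φ v := by
  obtain ⟨t, b⟩ := x
  cases b
  · have h1 : FreeGroup.mk [(t, false)] = (FreeGroup.of t)⁻¹ := by
      simp [FreeGroup.of, FreeGroup.invRev]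
    rw [h1, map_inv, Equiv.Perm.inv_eq_iff_eq]
    exact (h t v u (by simpa [StepAlong] using hs)).symm
  · exact h t u v (by simpa [StepAlong] using hs)

theorem act_mk_of_leadsTo {α Y V : Type} {E : α → V → V → Prop} {ρ : FreeGroup α →* Equiv.Perm Y}
    {φ : V → Y} (h : ∀ t u v, E t u v → ρ (FreeGroup.of t) (φ u) = φ v) {L : List (α × Bool)}
    {u v : V} (hs : LeadsTo E L u v) : ρ (FreeGroup.mk L) (φ u) = φ v := by
  induction L generalizing v with
  | nil => cases hs; rw [← FreeGroup.one_eq_mk]; simp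
  | cons x L ih =>
    obtain ⟨w, hw, hx⟩ := hs
    rw [act_mk_cons, ih hw, act_mk_of_stepAlong h hx]

theorem leadsTo_append {α V : Type} {E : α → V → V → Prop} {L M : List (α × Bool)} {u v w : V}
    (hM : LeadsTo E M u v) (hL : LeadsTo E L v w) : LeadsTo E (L ++ M) u w := by
  induction L generalizing w with
  | nil => cases hL; exact hM
  | cons x L ih =>
    obtain ⟨z, hz, hx⟩ := hL
    exact ⟨z, ih hz, hx⟩

/-- Adding an edge to a folded graph. -/
theorem IsFolded.add_edge {α V : Type} {E : α → V → V → Prop} (hE : IsFolded E) (s : α) {a b : V}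
    (ha : ∀ v, ¬ E s a v) (hb : ∀ u, ¬ E s u b) :
    IsFolded fun t u v => E t u v ∨ (t = s ∧ u = a ∧ v = b) := by
  intro t
  constructor
  · rintro u v w (h | ⟨rfl, rfl, rfl⟩) (h' | ⟨h1, h2, h3⟩)
    · exact (hE t).1 h h'
    · subst h3; exact absurd (h1 ▸ h) (hb _)
    · exact absurd h' (hb _)
    · exact h2.symm
  · rintro u v w (h | ⟨rfl, rfl, rfl⟩) (h' | ⟨h1, h2, h3⟩)
    · exact (hE t).2 h h'
    · subst h2; exact absurd (h1 ▸ h) (ha _)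
    · exact absurd h' (ha _)
    · exact h3.symm

/-- The graph `E` with one more edge, along which the letter `x` leads from `a` to `b`. -/
def addStep {α V : Type} (E : α → V → V → Prop) (x : α × Bool) (a b : V) (t : α) (u v : V) : Prop :=
  E t u v ∨ (t = x.1 ∧ if x.2 then u = a ∧ v = b else u = b ∧ v = a)

theorem isFolded_addStep {α V : Type} {E : α → V → V → Prop} (hE : IsFolded E) {x : α × Bool}
    {a b : V} (ha : ∀ v, ¬ StepAlong E x a v) (hb : ∀ u, ¬ StepAlong E x u b) :
    IsFolded (addStep E x a b) := by
  obtain ⟨s, β⟩ := x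
  cases β
  · have h : addStep E (s, false) a b = fun t u v => E t u v ∨ (t = s ∧ u = b ∧ v = a) := by
      funext t u v; simp [addStep]
    rw [h]
    exact hE.add_edge s (by simpa [StepAlong] using hb) (by simpa [StepAlong] using ha)
  · have h : addStep E (s, true) a b = fun t u v => E t u v ∨ (t = s ∧ u = a ∧ v = b) := by
      funext t u v; simp [addStep]
    rw [h]
    exact hE.add_edge s (by simpa [StepAlong] using ha) (by simpa [StepAlong] using hb)

theorem stepAlong_addStep_self {α V : Type} (E : α → V → V → Prop) (x : α × Bool) (a b : V) :
    StepAlong (addStep E x a b) x a b := by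
  obtain ⟨s, β⟩ := x
  cases β <;> simp [StepAlong, addStep]

theorem stepAlong_addStep {α V : Type} {E : α → V → V → Prop} {x z : α × Bool} {a b u v : V} :
    StepAlong (addStep E x a b) z u v ↔ StepAlong E z u v ∨ (z = x ∧ u = a ∧ v = b) ∨
      (z = (x.1, !x.2) ∧ u = b ∧ v = a) := by
  obtain ⟨s, β⟩ := x
  obtain ⟨t, γ⟩ := z
  cases β <;> cases γ <;> simp [StepAlong, addStep, and_comm]

/-! ### Attaching a word as an arc between consecutive levels. -/

/-- `ℤ` copies of a labelled graph, joined by a new edge from `a` on each level to `b` on the next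
level. -/
def helixGraph {α V : Type} (E : α → V → V → Prop) (s : α) (a b : V) (d : ℤ) (t : α)
    (p q : V × ℤ) : Prop :=
  (E t p.1 q.1 ∧ q.2 = p.2) ∨ (t = s ∧ p.1 = a ∧ q.1 = b ∧ q.2 = p.2 + d)

theorem isFolded_helixGraph {α V : Type} {E : α → V → V → Prop} (hE : IsFolded E) {s : α} {a b : V}
    (d : ℤ) (ha : ∀ v, ¬ E s a v) (hb : ∀ u, ¬ E s u b) : IsFolded (helixGraph E s a b d) := by
  intro t
  constructor
  · rintro ⟨u, k⟩ ⟨v, l⟩ ⟨w, n⟩ (⟨h, h1⟩ | ⟨h, h1, h2, h3⟩) (⟨h', h1'⟩ | ⟨h', h1', h2', h3'⟩) <;>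
      dsimp only at *
    · rw [(hE t).1 h h']; congr 1; omega
    · subst h'; subst h2'; exact absurd h (hb _)
    · subst h; subst h2; exact absurd h' (hb _)
    · rw [h1, h1']; congr 1; omega
  · rintro ⟨u, k⟩ ⟨v, l⟩ ⟨w, n⟩ (⟨h, h1⟩ | ⟨h, h1, h2, h3⟩) (⟨h', h1'⟩ | ⟨h', h1', h2', h3'⟩) <;>
      dsimp only at *
    · rw [(hE t).2 h h']; congr 1; omega
    · subst h'; subst h1'; exact absurd h (ha _)
    · subst h; subst h1; exact absurd h' (ha _)
    · rw [h2, h2']; congr 1; omega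

theorem exists_levelMap_of_letter {α V : Type} {E : α → V → V → Prop} (hE : IsFolded E)
    (v₀ x y : V) (l : α × Bool) (hy : ∀ v, ¬ StepAlong E l y v) (hx : ∀ u, ¬ StepAlong E l u x) :
    ∃ (Y : Type) (f : LevelMap E Y), Function.Injective (f.toFun v₀) ∧
      ∀ n, f.act (FreeGroup.mk [l]) (f.toFun y n) = f.toFun x (n + 1) := by
  obtain ⟨s, β⟩ := l
  cases β
  -- An inverted letter runs against its edge, so the edge goes from `x` to `y` and descends by one
  -- level.
  · obtain ⟨ρ, f, rfl, hf, hρ⟩ := (isFolded_helixGraph hE (s := s) (a := x) (b := y) (-1)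
      (by simpa [StepAlong] using hx) (by simpa [StepAlong] using hy)).exists_levelMap (E := E)
      (fun u n => (u, n)) (fun t u v n h => Or.inl ⟨h, rfl⟩)
    refine ⟨_, f, fun m n h => ?_, fun n => ?_⟩
    · simpa [hf] using h
    · rw [hf, hf]
      refine act_mk_of_stepAlong hρ ?_
      simp [StepAlong, helixGraph]
  · obtain ⟨ρ, f, rfl, hf, hρ⟩ := (isFolded_helixGraph hE (s := s) (a := y) (b := x) 1
      (by simpa [StepAlong] using hy) (by simpa [StepAlong] using hx)).exists_levelMap (E := E)
      (fun u n => (u, n)) (fun t u v n h => Or.inl ⟨h, rfl⟩)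
    refine ⟨_, f, fun m n h => ?_, fun n => ?_⟩
    · simpa [hf] using h
    · rw [hf, hf]
      refine act_mk_of_stepAlong hρ ?_
      simp [StepAlong, helixGraph]

/-- The graph `E` with an additional isolated vertex. -/
def addVertex {α V : Type} (E : α → V → V → Prop) (t : α) (u v : Option V) : Prop :=
  ∃ a b, E t a b ∧ u = some a ∧ v = some b

theorem isFolded_addVertex {α V : Type} {E : α → V → V → Prop} (hE : IsFolded E) :
    IsFolded (addVertex E) := by
  intro t
  constructor
  · rintro _ _ _ ⟨a, b, h, rfl, rfl⟩ ⟨a', b', h', rfl, h2⟩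
    cases h2
    rw [(hE t).1 h h']
  · rintro _ _ _ ⟨a, b, h, rfl, rfl⟩ ⟨a', b', h', h2, rfl⟩
    cases h2
    rw [(hE t).2 h h']

theorem stepAlong_addVertex {α V : Type} {E : α → V → V → Prop} {x : α × Bool} {u v : Option V} :
    StepAlong (addVertex E) x u v ↔ ∃ a b, StepAlong E x a b ∧ u = some a ∧ v = some b := by
  obtain ⟨t, β⟩ := x
  cases β
  · simp only [StepAlong, addVertex, Bool.false_eq_true, if_false]
    exact ⟨fun ⟨a, b, h, h1, h2⟩ => ⟨b, a, h, h2, h1⟩, fun ⟨a, b, h, h1, h2⟩ => ⟨b, a, h, h2, h1⟩⟩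
  · simp [StepAlong, addVertex]

/-- The graph `E` with a new vertex, to which the letter `x` leads from `a`. -/
def addHair {α V : Type} (E : α → V → V → Prop) (x : α × Bool) (a : V) :
    α → Option V → Option V → Prop :=
  addStep (addVertex E) x (some a) none

theorem isFolded_addHair {α V : Type} {E : α → V → V → Prop} (hE : IsFolded E) {x : α × Bool} {a : V}
    (ha : ∀ v, ¬ StepAlong E x a v) : IsFolded (addHair E x a) := by
  refine isFolded_addStep (isFolded_addVertex hE) (fun v hv => ?_) (fun u hu => ?_)
  · obtain ⟨a', b, h, h1, -⟩ := stepAlong_addVertex.1 hv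
    cases h1
    exact ha _ h
  · obtain ⟨a', b, h, -, h1⟩ := stepAlong_addVertex.1 hu
    cases h1

theorem stepAlong_addHair {α V : Type} {E : α → V → V → Prop} {x z : α × Bool} {a : V}
    {u v : Option V} : StepAlong (addHair E x a) z u v ↔
      (∃ a b, StepAlong E z a b ∧ u = some a ∧ v = some b) ∨ (z = x ∧ u = some a ∧ v = none) ∨
      (z = (x.1, !x.2) ∧ u = none ∧ v = some a) := by
  rw [addHair, stepAlong_addStep, stepAlong_addVertex]

/-- Restriction of a compatible map on the graph with a new vertex. -/
def LevelMap.ofAddHair {α V Y : Type} {E : α → V → V → Prop} {x : α × Bool} {a : V}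
    (f : LevelMap (addHair E x a) Y) : LevelMap E Y where
  act := f.act
  toFun u := f.toFun (some u)
  map_edge t u v n h := f.map_edge t _ _ n (Or.inl ⟨u, v, h, rfl, rfl⟩)

theorem LevelMap.act_addHair {α V Y : Type} {E : α → V → V → Prop} {x : α × Bool} {a : V}
    (f : LevelMap (addHair E x a) Y) (n : ℤ) :
    f.act (FreeGroup.mk [x]) (f.toFun (some a) n) = f.toFun none n :=
  act_mk_of_stepAlong (φ := fun u => f.toFun u n) (fun t u v h => f.map_edge t u v n h)
    (stepAlong_addStep_self _ _ _ _)

theorem LevelMap.act_addHair_inv {α V Y : Type} {E : α → V → V → Prop} {x : α × Bool} {a : V}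
    (f : LevelMap (addHair E x a) Y) (n : ℤ) :
    f.act (FreeGroup.mk [(x.1, !x.2)]) (f.toFun none n) = f.toFun (some a) n :=
  act_mk_of_stepAlong (φ := fun u => f.toFun u n) (fun t u v h => f.map_edge t u v n h)
    (stepAlong_addHair.2 (Or.inr (Or.inr ⟨rfl, rfl, rfl⟩)))

/-- A nonempty reduced word that can be read from neither end can be added to the graph as an arc
which rises by one level. -/
theorem exists_levelMap_of_word {α : Type} (M : List (α × Bool)) (hM : M ≠ [])
    (hred : FreeGroup.IsReduced M) {V : Type} {E : α → V → V → Prop} (hE : IsFolded E) (v₀ x y : V)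
    (hy : ∀ l ∈ M.getLast?, ∀ v, ¬ StepAlong E l y v)
    (hx : ∀ l ∈ M.head?, ∀ u, ¬ StepAlong E l u x) :
    ∃ (Y : Type) (f : LevelMap E Y), Function.Injective (f.toFun v₀) ∧
      ∀ n, f.act (FreeGroup.mk M) (f.toFun y n) = f.toFun x (n + 1) := by
  induction hn : M.length using Nat.strong_induction_on generalizing M V with
  | _ k ih =>
  obtain ⟨N, l, rfl⟩ : ∃ N l, M = N ++ [l] := ⟨_, _, (List.dropLast_append_getLast hM).symm⟩
  have hy' : ∀ v, ¬ StepAlong E l y v := hy l (by simp)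
  rcases N with _ | ⟨h, N⟩
  · exact exists_levelMap_of_letter hE v₀ x y l hy' (hx l (by simp))
  have hx' : ∀ u, ¬ StepAlong E h u x := hx h (by simp)
  have hfold := isFolded_addHair hE hy'
  have hlast : ∀ z ∈ (h :: N).getLast?, z ≠ (l.1, !l.2) := by
    rintro z hz rfl
    have := (List.isChain_append.1 hred).2.2 _ hz l (by simp) rfl
    simp at this
  -- The letter `l` is read first and becomes a hair at `y`; the rest of the word starts at its tip.
  -- This fails only if the final letter would enter `x` along this same hair. Then the word is a
  -- conjugate by `l`, both of its end letters run along the hair, and the inner word becomes a loop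
  -- at the tip.
  by_cases hc : h = (l.1, !l.2) ∧ x = y
  · obtain ⟨rfl, rfl⟩ := hc
    rcases N with _ | ⟨h', N⟩
    · exact absurd rfl (hlast (l.1, !l.2) (by simp))
    have hred' : FreeGroup.IsReduced (h' :: N) :=
      hred.infix ⟨[(l.1, !l.2)], [l], by simp⟩
    have hy₁ : ∀ z ∈ (h' :: N).getLast?, ∀ v, ¬ StepAlong (addHair E l x) z none v := by
      intro z hz v hv
      rcases stepAlong_addHair.1 hv with ⟨a, b, -, h1, -⟩ | ⟨-, h1, -⟩ | ⟨h1, -, -⟩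
      · cases h1
      · cases h1
      · exact hlast z (by simpa using hz) h1
    have hx₁ : ∀ z ∈ (h' :: N).head?, ∀ u, ¬ StepAlong (addHair E l x) z u none := by
      intro z hz u hu
      simp only [List.head?_cons, Option.mem_def, Option.some.injEq] at hz
      subst hz
      rcases stepAlong_addHair.1 hu with ⟨a, b, -, -, h1⟩ | ⟨h1, -, -⟩ | ⟨-, -, h1⟩
      · cases h1
      · subst h1
        have := (FreeGroup.isReduced_cons_cons.1 hred).1 rfl
        simp at this
      · cases h1
    obtain ⟨Y, f, hf, hf'⟩ := ih (h' :: N).length (by simp at hn ⊢; omega) (h' :: N) (by simp) hred'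
      hfold (some v₀) none none hy₁ hx₁ rfl
    refine ⟨Y, f.ofAddHair, hf, fun n => ?_⟩
    change f.act _ (f.toFun (some x) n) = f.toFun (some x) (n + 1)
    rw [act_mk_append, f.act_addHair, act_mk_cons, hf', f.act_addHair_inv]
  · have hy₁ : ∀ z ∈ (h :: N).getLast?, ∀ v, ¬ StepAlong (addHair E l y) z none v := by
      intro z hz v hv
      rcases stepAlong_addHair.1 hv with ⟨a, b, -, h1, -⟩ | ⟨-, h1, -⟩ | ⟨h1, -, -⟩
      · cases h1
      · cases h1
      · exact hlast z hz h1
    have hx₁ : ∀ z ∈ (h :: N).head?, ∀ u, ¬ StepAlong (addHair E l y) z u (some x) := by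
      intro z hz u hu
      simp only [List.head?_cons, Option.mem_def, Option.some.injEq] at hz
      subst hz
      rcases stepAlong_addHair.1 hu with ⟨a, b, h2, -, h1⟩ | ⟨-, -, h1⟩ | ⟨h2, -, h1⟩
      · cases h1
        exact hx' _ h2
      · cases h1
      · exact hc ⟨h2, Option.some.inj h1⟩
    obtain ⟨Y, f, hf, hf'⟩ := ih (h :: N).length (by simp at hn ⊢; omega) (h :: N) (by simp)
      (hred.infix ⟨[], [l], by simp⟩) hfold (some v₀) (some x) none hy₁ hx₁ rfl
    refine ⟨Y, f.ofAddHair, hf, fun n => ?_⟩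
    change f.act _ (f.toFun (some y) n) = f.toFun (some x) (n + 1)
    rw [act_mk_append, f.act_addHair, hf']

/-! ### Reading a word from both ends. -/

/-- If all shifts of pairs of distinct vertices are possible, then every word either leads from `v₀`
to `v₀` or can be made to raise the level of `v₀` by one. -/
theorem leadsTo_or_exists_levelMap {α V : Type} {E : α → V → V → Prop} (hE : IsFolded E) (v₀ : V)
    (hs : ∀ x y, x ≠ y → CanShift E v₀ x y) (g : FreeGroup α) :
    (∃ L, g = FreeGroup.mk L ∧ LeadsTo E L v₀ v₀) ∨
    ∃ (Y : Type) (f : LevelMap E Y), Function.Injective (f.toFun v₀) ∧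
      ∀ n, f.act g (f.toFun v₀ n) = f.toFun v₀ (n + 1) := by
  classical
  -- Choose a decomposition whose unread middle part `M` is shortest; reading nothing at all shows
  -- that one exists.
  have hex : ∃ k, ∃ P M S : List (α × Bool), ∃ x y, g.toWord = P ++ (M ++ S) ∧ LeadsTo E S v₀ y ∧
      LeadsTo E P x v₀ ∧ M.length = k := ⟨_, [], g.toWord, [], v₀, v₀, by simp, rfl, rfl, rfl⟩
  obtain ⟨P, M, S, x, y, hg, hS, hP, hM⟩ := Nat.find_spec hex
  have hmin : ∀ P' M' S' x' y', g.toWord = P' ++ (M' ++ S') → LeadsTo E S' v₀ y' →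
      LeadsTo E P' x' v₀ → M.length ≤ M'.length := fun P' M' S' x' y' h1 h2 h3 => by
    rw [hM]
    exact Nat.find_min' hex ⟨P', M', S', x', y', h1, h2, h3, rfl⟩
  have hg' : g = FreeGroup.mk (P ++ (M ++ S)) := by rw [← hg, FreeGroup.mk_toWord]
  have hkey : ∀ {Y : Type} (f : LevelMap E Y),
      (∀ n, f.act (FreeGroup.mk M) (f.toFun y n) = f.toFun x (n + 1)) →
      ∀ n, f.act g (f.toFun v₀ n) = f.toFun v₀ (n + 1) := by
    intro Y f hf n
    have hl : ∀ n, ∀ {L : List (α × Bool)} {u v : V}, LeadsTo E L u v →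
        f.act (FreeGroup.mk L) (f.toFun u n) = f.toFun v n := fun n _ _ _ h =>
      act_mk_of_leadsTo (φ := fun u => f.toFun u n) (fun t u v h => f.map_edge t u v n h) h
    rw [hg', act_mk_append, act_mk_append, hl n hS, hf, hl _ hP]
  by_cases hM0 : M = []
  · subst hM0
    by_cases hxy : x = y
    · subst hxy
      exact Or.inl ⟨P ++ S, by simpa using hg', leadsTo_append hS hP⟩
    · obtain ⟨Y, f, hf, hf'⟩ := hs x y hxy
      refine Or.inr ⟨Y, f, hf, hkey f fun n => ?_⟩
      rw [← FreeGroup.one_eq_mk]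
      simpa using hf' n
  · have hred : FreeGroup.IsReduced M := by
      have := FreeGroup.isReduced_toWord (x := g)
      rw [hg] at this
      exact this.infix ⟨P, S, by simp⟩
    -- If an end letter of `M` could be read in the graph, moving it into `S` or `P` would shorten
    -- `M`.
    have hy : ∀ l ∈ M.getLast?, ∀ v, ¬ StepAlong E l y v := by
      intro l hl v hv
      obtain ⟨N, rfl⟩ : ∃ N, M = N ++ [l] :=
        ⟨M.dropLast, (List.dropLast_append_getLast? l hl).symm⟩
      have := hmin P N (l :: S) x v (by simpa using hg) ⟨y, hS, hv⟩ hP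
      simp at this
    have hx : ∀ l ∈ M.head?, ∀ u, ¬ StepAlong E l u x := by
      intro l hl u hu
      obtain ⟨N, rfl⟩ : ∃ N, M = l :: N := ⟨M.tail, (List.cons_head?_tail hl).symm⟩
      have := hmin (P ++ [l]) N S u y (by simpa using hg) hS
        (leadsTo_append (M := [l]) ⟨u, rfl, hu⟩ hP)
      simp at this
    obtain ⟨Y, f, hf, hf'⟩ := exists_levelMap_of_word M hM0 hred hE v₀ x y hy hx
    exact Or.inr ⟨Y, f, hf, hkey f hf'⟩

/-! ### Graphs of lines glued at junctions. -/

/-- Two points on the lines of the two directions are glued if they carry the same junction. -/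
def GlueRel {Q T : Type} (Φ : Fin 2 → Q → T × ℤ) (p p' : Fin 2 × T × ℤ) : Prop :=
  p = p' ∨ ∃ q, p.1 ≠ p'.1 ∧ Φ p.1 q = p.2 ∧ Φ p'.1 q = p'.2

/-- The points on the lines of both directions, glued at the junctions. -/
def RulerVertex {Q T : Type} (Φ : Fin 2 → Q → T × ℤ) : Type := Quot (GlueRel Φ)

/-- The vertex at the position `u.2` on the line `u.1` of direction `t`. -/
def RulerVertex.mk {Q T : Type} (Φ : Fin 2 → Q → T × ℤ) (t : Fin 2) (u : T × ℤ) : RulerVertex Φ :=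
  Quot.mk _ (t, u)

/-- The unit steps along the lines. -/
def rulerEdge {Q T : Type} (Φ : Fin 2 → Q → T × ℤ) (t : Fin 2) (u v : RulerVertex Φ) : Prop :=
  ∃ s p, u = .mk Φ t (s, p) ∧ v = .mk Φ t (s, p + 1)

/-- Junctions which agree in one direction agree in the other one. -/
def SameKernel {Q T : Type} (Φ : Fin 2 → Q → T × ℤ) : Prop :=
  ∀ t t' q q', Φ t q = Φ t q' → Φ t' q = Φ t' q'

theorem SameKernel.equivalence {Q T : Type} {Φ : Fin 2 → Q → T × ℤ} (h : SameKernel Φ) :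
    Equivalence (GlueRel Φ) := by
  refine ⟨fun _ => Or.inl rfl, ?_, ?_⟩
  · rintro p p' (rfl | ⟨q, h1, h2, h3⟩)
    · exact Or.inl rfl
    · exact Or.inr ⟨q, h1.symm, h3, h2⟩
  · rintro p p' p'' (rfl | ⟨q, h1, h2, h3⟩) (rfl | ⟨q', h1', h2', h3'⟩)
    · exact Or.inl rfl
    · exact Or.inr ⟨q', h1', h2', h3'⟩
    · exact Or.inr ⟨q, h1, h2, h3⟩
    -- Two changes of direction lead back to the original one, and `SameKernel` makes the two points
    -- there agree.
    · left
      have ht : p.1 = p''.1 := by omega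
      refine Prod.ext ht ?_
      rw [← h2, ← h3', ← ht]
      exact h _ _ _ _ (h3.trans h2'.symm)

theorem SameKernel.mk_eq_mk {Q T : Type} {Φ : Fin 2 → Q → T × ℤ} (h : SameKernel Φ) {t t' : Fin 2}
    {u u' : T × ℤ} :
    RulerVertex.mk Φ t u = RulerVertex.mk Φ t' u' ↔ GlueRel Φ (t, u) (t', u') :=
  h.equivalence.quot_mk_eq_iff _ _

theorem SameKernel.mk_inj {Q T : Type} {Φ : Fin 2 → Q → T × ℤ} (h : SameKernel Φ) {t : Fin 2}
    {u u' : T × ℤ} : RulerVertex.mk Φ t u = RulerVertex.mk Φ t u' ↔ u = u' := by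
  rw [h.mk_eq_mk]
  constructor
  · rintro (h | ⟨q, h, -⟩)
    · exact (Prod.mk.inj h).2
    · exact absurd rfl h
  · rintro rfl
    exact Or.inl rfl

/-- The gluing identifies no two points of the same direction, so on each direction the edges remain
the unit translation of disjoint lines. -/
theorem SameKernel.isFolded {Q T : Type} {Φ : Fin 2 → Q → T × ℤ} (h : SameKernel Φ) :
    IsFolded (rulerEdge Φ) := by
  intro t
  constructor
  · rintro _ _ _ ⟨s, p, rfl, rfl⟩ ⟨s', p', rfl, h2⟩
    rw [h.mk_inj, Prod.mk.injEq] at h2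
    rw [h2.1, add_right_cancel h2.2]
  · rintro _ _ _ ⟨s, p, rfl, rfl⟩ ⟨s', p', h2, rfl⟩
    rw [h.mk_inj, Prod.mk.injEq] at h2
    rw [h2.1, h2.2]

theorem RulerVertex.mk_junction {Q T : Type} (Φ : Fin 2 → Q → T × ℤ) (t t' : Fin 2) (q : Q) :
    RulerVertex.mk Φ t (Φ t q) = RulerVertex.mk Φ t' (Φ t' q) := by
  by_cases h : t = t'
  · rw [h]
  · exact Quot.sound (Or.inr ⟨q, h, rfl, rfl⟩)

/-- The vertex of a junction. -/
def junctionVertex {Q T : Type} (Φ : Fin 2 → Q → T × ℤ) (q : Q) : RulerVertex Φ := .mk Φ 0 (Φ 0 q)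

theorem mk_eq_junctionVertex {Q T : Type} (Φ : Fin 2 → Q → T × ℤ) (t : Fin 2) (q : Q) :
    RulerVertex.mk Φ t (Φ t q) = junctionVertex Φ q := RulerVertex.mk_junction Φ t 0 q

theorem act_zpow_mk {Q T Y : Type} {Φ : Fin 2 → Q → T × ℤ} {ρ : FreeGroup (Fin 2) →* Equiv.Perm Y}
    {φ : RulerVertex Φ → Y}
    (h : ∀ t u v, rulerEdge Φ t u v → ρ (FreeGroup.of t) (φ u) = φ v) (t : Fin 2) (s : T)
    (p d : ℤ) : ρ (FreeGroup.of t ^ d) (φ (.mk Φ t (s, p))) = φ (.mk Φ t (s, p + d)) := by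
  induction d with
  | zero => simp
  | succ n ih =>
    rw [add_comm, zpow_add, map_mul, Equiv.Perm.mul_apply, ih, zpow_one,
      h t _ _ ⟨s, p + n, rfl, rfl⟩, add_comm 1 (n : ℤ), add_assoc]
  | pred n ih =>
    rw [sub_eq_add_neg, add_comm, zpow_add, map_mul, Equiv.Perm.mul_apply, ih, zpow_neg_one, map_inv,
      Equiv.Perm.inv_eq_iff_eq, h t _ _ ⟨s, p + (-1 + -n), rfl, rfl⟩]
    congr 3
    ring

/-! ### Shifting vertices in graphs of lines. -/

/-- The position of a point after its line has been placed, level by level, on other lines. -/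
def place {T T' : Type} (A : T → ℤ → T' × ℤ) (u : T × ℤ) (n : ℤ) : T' × ℤ :=
  ((A u.1 n).1, (A u.1 n).2 + u.2)

/-- A shift is possible if `ℤ` copies of the lines can be placed on other lines such that it takes
place and such that junctions collide in one direction if and only if they do in the other one. -/
theorem canShift_of_place {J T T' : Type} {Φ : Fin 2 → J → T × ℤ} {t t' : Fin 2} (htt : t ≠ t')
    (A B : T → ℤ → T' × ℤ)
    (hker : ∀ j n j' n', place A (Φ t j) n = place A (Φ t j') n' ↔
      place B (Φ t' j) n = place B (Φ t' j') n') (j₀ : J)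
    (hinj : ∀ n n', place A (Φ t j₀) n = place A (Φ t j₀) n' → n = n') (u u' : T × ℤ)
    (hu : ∀ n, place A u' n = place A u (n + 1)) :
    CanShift (rulerEdge Φ) (junctionVertex Φ j₀) (.mk Φ t u) (.mk Φ t u') := by
  classical
  let C : Fin 2 → T → ℤ → T' × ℤ := fun r => if r = t then A else B
  have hCt : C t = A := by simp [C]
  have hCt' : C t' = B := by simp [C, htt.symm]
  let Ψ : Fin 2 → J × ℤ → T' × ℤ := fun r q => place (C r) (Φ r q.1) q.2
  have hcases : ∀ r, r = t ∨ r = t' := fun r => by omega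
  have hΨ : SameKernel Ψ := by
    rintro r r' ⟨j, n⟩ ⟨j', n'⟩ h
    rcases hcases r with rfl | rfl <;> rcases hcases r' with rfl | rfl <;>
      simp only [Ψ, hCt, hCt'] at h ⊢
    · exact h
    · exact (hker _ _ _ _).1 h
    · exact (hker _ _ _ _).2 h
    · exact h
  let φ : RulerVertex Φ → ℤ → RulerVertex Ψ := fun v n =>
    Quot.lift (fun p : Fin 2 × T × ℤ => RulerVertex.mk Ψ p.1 (place (C p.1) p.2 n)) (by
      rintro p p' (rfl | ⟨j, h1, h2, h3⟩)
      · rfl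
      · rw [← h2, ← h3]
        exact RulerVertex.mk_junction Ψ p.1 p'.1 (j, n)) v
  have hφ : ∀ r v n, φ (.mk Φ r v) n = .mk Ψ r (place (C r) v n) := fun _ _ _ => rfl
  obtain ⟨ρ, f, -, hf, -⟩ := hΨ.isFolded.exists_levelMap (E := rulerEdge Φ) φ (by
    rintro r _ _ n ⟨s, p, rfl, rfl⟩
    exact ⟨(C r s n).1, (C r s n).2 + p, hφ _ _ _, by rw [hφ, add_assoc]; rfl⟩)
  refine ⟨_, f, fun n n' h => ?_, fun n => ?_⟩
  · rw [hf, hf, Sum.inl.injEq, ← mk_eq_junctionVertex Φ t, hφ, hφ, hΨ.mk_inj, hCt] at h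
    exact hinj n n' h
  · rw [hf, hf, hφ, hφ, hCt, hu]

/-- Vertices which are not incident to edges with the same label can be shifted. -/
theorem canShift_of_not_incident {α V : Type} {E : α → V → V → Prop} (hE : IsFolded E) (v₀ x y : V)
    (hxy : x ≠ y)
    (h : ∀ t, ¬ ((∃ u, E t x u ∨ E t u x) ∧ ∃ u, E t y u ∨ E t u y)) : CanShift E v₀ x y := by
  classical
  let φ : V → ℤ → V × ℤ := fun u n => if u = y then (x, n + 1) else (u, n)
  have hφ : ∀ u n u' n', φ u n = φ u' n' → (u = u' ∧ n = n') ∨ (u = x ∧ u' = y) ∨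
      (u = y ∧ u' = x) := by
    intro u n u' n' huu
    -- Only copies of `x` and `y` are identified. They share no label, so no folding is needed.
    by_cases h1 : u = y <;> by_cases h2 : u' = y <;> simp [φ, h1, h2] at huu
    · exact Or.inl ⟨h1.trans h2.symm, huu⟩
    · exact Or.inr (Or.inr ⟨h1, huu.1.symm⟩)
    · exact Or.inr (Or.inl ⟨huu.1, h2⟩)
    · exact Or.inl huu
  have hfold : IsFolded fun t p q => ∃ u v n, E t u v ∧ p = φ u n ∧ q = φ v n := by
    intro t
    constructor
    · rintro _ _ _ ⟨u, v, n, he, rfl, rfl⟩ ⟨u', v', n', he', rfl, hv⟩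
      rcases hφ _ _ _ _ hv with ⟨rfl, rfl⟩ | ⟨rfl, rfl⟩ | ⟨rfl, rfl⟩
      · rw [(hE t).1 he he']
      · exact absurd ⟨⟨_, Or.inr he⟩, ⟨_, Or.inr he'⟩⟩ (h t)
      · exact absurd ⟨⟨_, Or.inr he'⟩, ⟨_, Or.inr he⟩⟩ (h t)
    · rintro _ _ _ ⟨u, v, n, he, rfl, rfl⟩ ⟨u', v', n', he', hu, rfl⟩
      rcases hφ _ _ _ _ hu with ⟨rfl, rfl⟩ | ⟨rfl, rfl⟩ | ⟨rfl, rfl⟩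
      · rw [(hE t).2 he he']
      · exact absurd ⟨⟨_, Or.inl he⟩, ⟨_, Or.inl he'⟩⟩ (h t)
      · exact absurd ⟨⟨_, Or.inl he'⟩, ⟨_, Or.inl he⟩⟩ (h t)
  obtain ⟨ρ, f, -, hf, -⟩ := hfold.exists_levelMap (E := E) φ
    (fun t u v n he => ⟨u, v, n, he, rfl, rfl⟩)
  refine ⟨_, f, fun n n' hn => ?_, fun n => ?_⟩
  · rw [hf, hf, Sum.inl.injEq] at hn
    by_cases h1 : v₀ = y <;> simpa [φ, h1] using hn
  · simp [hf, φ, hxy]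

/-- The differences of distinct points on a common line determine the points. -/
def IsSidon {J T : Type} (φ : J → T × ℤ) : Prop :=
  ∀ j₁ j₂ j₃ j₄, (φ j₁).1 = (φ j₂).1 → (φ j₃).1 = (φ j₄).1 →
    (φ j₂).2 - (φ j₁).2 = (φ j₄).2 - (φ j₃).2 → j₁ ≠ j₂ → j₁ = j₃ ∧ j₂ = j₄

theorem IsSidon.injective {J T : Type} {φ : J → T × ℤ} (h : IsSidon φ) : Function.Injective φ := by
  intro j j' hj
  by_contra hne
  have := h j j' j j (by rw [hj]) rfl (by rw [hj]) hne
  exact hne this.2.symm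

theorem IsSidon.eq {J T : Type} {φ : J → T × ℤ} (h : IsSidon φ) {j j' : J}
    (h1 : (φ j).1 = (φ j').1) (h2 : (φ j).2 = (φ j').2) : j = j' :=
  h.injective (Prod.ext h1 h2)

/-- Two points of the same line can be shifted: the line winds up to a helix. -/
theorem canShift_of_same_line {J T : Type} {Φ : Fin 2 → J → T × ℤ} (hΦ : ∀ t, IsSidon (Φ t))
    (hlin : ∀ j j', (Φ 0 j).1 = (Φ 0 j').1 → (Φ 1 j).1 = (Φ 1 j').1 → j = j') (j₀ : J) (t : Fin 2)
    (s₀ : T) {p p' : ℤ} (hp : p ≠ p') :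
    CanShift (rulerEdge Φ) (junctionVertex Φ j₀) (.mk Φ t (s₀, p)) (.mk Φ t (s₀, p')) := by
  classical
  obtain ⟨t', htt⟩ : ∃ t' : Fin 2, t ≠ t' := ⟨t + 1, by omega⟩
  have hlin' : ∀ j j', (Φ t j).1 = (Φ t j').1 → (Φ t' j).1 = (Φ t' j').1 → j = j' := by
    intro j j' h1 h2
    have : (t = 0 ∧ t' = 1) ∨ (t = 1 ∧ t' = 0) := by omega
    rcases this with ⟨rfl, rfl⟩ | ⟨rfl, rfl⟩
    · exact hlin j j' h1 h2
    · exact hlin j j' h2 h1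
  have he : p' - p ≠ 0 := sub_ne_zero.2 hp.symm
  set e := p' - p with he_def
  -- All levels of `s₀` go to a single line, each moved by `e` from the previous one. A crossing
  -- line meets `s₀` in only one junction by `hlin'`; `B` names its image by the new position of
  -- this junction and puts the junction at the origin. Thus crossing lines are superposed exactly
  -- when their junctions with `s₀` collide.
  let A : T → ℤ → (T × ℤ ⊕ ℤ) × ℤ := fun s n =>
    if s = s₀ then (Sum.inr 0, e * n) else (Sum.inl (s, n), 0)
  let B : T → ℤ → (T × ℤ ⊕ ℤ) × ℤ := fun s n =>
    if h : ∃ j, (Φ t' j).1 = s ∧ (Φ t j).1 = s₀ then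
      (Sum.inr ((Φ t h.choose).2 + e * n), -(Φ t' h.choose).2) else (Sum.inl (s, n), 0)
  have hA1 : ∀ u n, u.1 = s₀ → place A u n = (Sum.inr 0, e * n + u.2) := fun u n h => by
    simp [place, A, h]
  have hA2 : ∀ u n, u.1 ≠ s₀ → place A u n = (Sum.inl (u.1, n), u.2) := fun u n h => by
    simp [place, A, h]
  have hB1 : ∀ j k n, (Φ t k).1 = s₀ → (Φ t' k).1 = (Φ t' j).1 →
      place B (Φ t' j) n = (Sum.inr ((Φ t k).2 + e * n), (Φ t' j).2 - (Φ t' k).2) := by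
    intro j k n hk hjk
    have h : ∃ k, (Φ t' k).1 = (Φ t' j).1 ∧ (Φ t k).1 = s₀ := ⟨k, hjk, hk⟩
    have hc : h.choose = k :=
      hlin' _ _ (h.choose_spec.2.trans hk.symm) (h.choose_spec.1.trans hjk.symm)
    simp only [place, B, dif_pos h, hc]
    congr 1
    ring
  have hB2 : ∀ j n, (¬ ∃ k, (Φ t' k).1 = (Φ t' j).1 ∧ (Φ t k).1 = s₀) →
      place B (Φ t' j) n = (Sum.inl ((Φ t' j).1, n), (Φ t' j).2) := by
    intro j n h
    simp [place, B, dif_neg h]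
  refine canShift_of_place htt A B ?_ j₀ ?_ _ _ ?_
  · intro j n j' n'
    constructor
    · intro h
      by_cases h1 : (Φ t j).1 = s₀ <;> by_cases h2 : (Φ t j').1 = s₀
      · rw [hA1 _ _ h1, hA1 _ _ h2] at h
        rw [hB1 j j n h1 rfl, hB1 j' j' n' h2 rfl]
        simp only [Prod.mk.injEq, true_and] at h
        rw [sub_self, sub_self, add_comm, h, add_comm]
      · rw [hA1 _ _ h1, hA2 _ _ h2] at h
        simp at h
      · rw [hA2 _ _ h1, hA1 _ _ h2] at h
        simp at h
      · rw [hA2 _ _ h1, hA2 _ _ h2] at h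
        simp only [Prod.mk.injEq, Sum.inl.injEq] at h
        rw [(hΦ t).eq h.1.1 h.2, h.1.2]
    · intro h
      by_cases h1 : ∃ k, (Φ t' k).1 = (Φ t' j).1 ∧ (Φ t k).1 = s₀ <;>
        by_cases h2 : ∃ k, (Φ t' k).1 = (Φ t' j').1 ∧ (Φ t k).1 = s₀
      · obtain ⟨k, hk, hk'⟩ := h1
        obtain ⟨l, hl, hl'⟩ := h2
        rw [hB1 j k n hk' hk, hB1 j' l n' hl' hl] at h
        simp only [Prod.mk.injEq, Sum.inr.injEq] at h
        -- Away from the crossings `k` and `l`, equal offsets force the same junction on the same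
        -- line by the Sidon property. A zero offset means that both junctions are the crossings
        -- themselves.
        by_cases hkj : k = j
        · subst hkj
          by_cases hlj : l = j'
          · subst hlj
            rw [hA1 _ _ hk', hA1 _ _ hl']
            simp only [Prod.mk.injEq, true_and]
            linarith [h.1]
          · have := hΦ t' l j' k k hl hk h.2.symm hlj
            exact absurd (this.1.trans this.2.symm) hlj
        · obtain ⟨rfl, rfl⟩ := hΦ t' k j l j' hk hl h.2 hkj
          rw [mul_left_cancel₀ he (add_left_cancel h.1)]
      · obtain ⟨k, hk, hk'⟩ := h1
        rw [hB1 j k n hk' hk, hB2 _ _ h2] at h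
        simp at h
      · obtain ⟨l, hl, hl'⟩ := h2
        rw [hB2 _ _ h1, hB1 j' l n' hl' hl] at h
        simp at h
      · rw [hB2 _ _ h1, hB2 _ _ h2] at h
        simp only [Prod.mk.injEq, Sum.inl.injEq] at h
        rw [(hΦ t').eq h.1.1 h.2, h.1.2]
  · intro n n' h
    by_cases h1 : (Φ t j₀).1 = s₀
    · rw [hA1 _ _ h1, hA1 _ _ h1] at h
      simpa [he] using h
    · rw [hA2 _ _ h1, hA2 _ _ h1] at h
      simpa using h
  · intro n
    rw [hA1 _ _ rfl, hA1 _ _ rfl]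
    simp only [Prod.mk.injEq, true_and, he_def]
    ring

open Classical in
/-- Place the line `b` on each level on the line `a` of the next level, with offset `d`. -/
noncomputable def mergeLines {T : Type} (a b : T) (d : ℤ) (s : T) (n : ℤ) : (T × ℤ) × ℤ :=
  if s = b then ((a, n + 1), d) else ((s, n), 0)

theorem place_mergeLines_right {T : Type} (a b : T) (d q n : ℤ) :
    place (mergeLines a b d) (b, q) n = ((a, n + 1), d + q) := by
  simp [place, mergeLines]

theorem place_mergeLines_of_ne {T : Type} {a b : T} (d : ℤ) {u : T × ℤ} (n : ℤ) (h : u.1 ≠ b) :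
    place (mergeLines a b d) u n = ((u.1, n), u.2) := by
  simp [place, mergeLines, h]

theorem place_mergeLines_eq_iff {T : Type} {a b : T} (hab : a ≠ b) (d : ℤ) (u v : T × ℤ)
    (m n : ℤ) : place (mergeLines a b d) u m = place (mergeLines a b d) v n ↔
      (u = v ∧ m = n) ∨ (u.1 = a ∧ v.1 = b ∧ m = n + 1 ∧ u.2 = d + v.2) ∨
      (u.1 = b ∧ v.1 = a ∧ n = m + 1 ∧ v.2 = d + u.2) := by
  obtain ⟨s, p⟩ := u
  obtain ⟨r, q⟩ := v
  by_cases h1 : s = b <;> by_cases h2 : r = b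
  · subst h1 h2
    simp [place_mergeLines_right, hab.symm, and_comm]
  · subst h1
    rw [place_mergeLines_right, place_mergeLines_of_ne _ _ h2]
    simp [hab.symm, Ne.symm h2]
    grind
  · subst h2
    rw [place_mergeLines_right, place_mergeLines_of_ne _ _ h1]
    simp [h1]
    grind
  · rw [place_mergeLines_of_ne _ _ h1, place_mergeLines_of_ne _ _ h2]
    simp [h1, h2]
    grind

/-- When two different lines are superposed so that `j₁` and `j₂` meet, a second collision would
yield equal differences on both lines, which the Sidon property forbids. -/
theorem place_mergeLines_junction_iff {J T : Type} {φ : J → T × ℤ} (h : IsSidon φ) {j₁ j₂ : J}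
    (hne : (φ j₁).1 ≠ (φ j₂).1) (j k : J) (m n : ℤ) :
    place (mergeLines (φ j₁).1 (φ j₂).1 ((φ j₁).2 - (φ j₂).2)) (φ j) m =
      place (mergeLines (φ j₁).1 (φ j₂).1 ((φ j₁).2 - (φ j₂).2)) (φ k) n ↔
      (j = k ∧ m = n) ∨ (j = j₁ ∧ k = j₂ ∧ m = n + 1) ∨ (j = j₂ ∧ k = j₁ ∧ n = m + 1) := by
  have key : ∀ j k, (φ j).1 = (φ j₁).1 → (φ k).1 = (φ j₂).1 →
      (φ j).2 = (φ j₁).2 - (φ j₂).2 + (φ k).2 → j = j₁ ∧ k = j₂ := by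
    intro j k h1 h2 h3
    by_cases hj : j = j₁
    · subst hj
      exact ⟨rfl, h.eq h2 (by linarith)⟩
    · have := h j j₁ k j₂ h1 h2 (by linarith) hj
      rw [this.1, h2] at h1
      exact absurd h1.symm hne
  rw [place_mergeLines_eq_iff hne, h.injective.eq_iff]
  constructor
  · rintro (h1 | ⟨h1, h2, h3, h4⟩ | ⟨h1, h2, h3, h4⟩)
    · exact Or.inl h1
    · obtain ⟨rfl, rfl⟩ := key j k h1 h2 h4
      exact Or.inr (Or.inl ⟨rfl, rfl, h3⟩)
    · obtain ⟨rfl, rfl⟩ := key k j h2 h1 h4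
      exact Or.inr (Or.inr ⟨rfl, rfl, h3⟩)
  · rintro (h1 | ⟨rfl, rfl, h1⟩ | ⟨rfl, rfl, h1⟩)
    · exact Or.inl h1
    · exact Or.inr (Or.inl ⟨rfl, rfl, h1, by ring⟩)
    · exact Or.inr (Or.inr ⟨rfl, rfl, h1, by ring⟩)

/-- Moving a shift along lines. -/
theorem CanShift.slide {J T : Type} {Φ : Fin 2 → J → T × ℤ} {v₀ : RulerVertex Φ} {t : Fin 2}
    {s s' : T} {p p' : ℤ} (h : CanShift (rulerEdge Φ) v₀ (.mk Φ t (s, p)) (.mk Φ t (s', p')))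
    (d : ℤ) : CanShift (rulerEdge Φ) v₀ (.mk Φ t (s, p + d)) (.mk Φ t (s', p' + d)) := by
  obtain ⟨Y, f, hf, hf'⟩ := h
  refine ⟨Y, f, hf, fun n => ?_⟩
  have hz : ∀ n s p, f.act (FreeGroup.of t ^ d) (f.toFun (.mk Φ t (s, p)) n) =
      f.toFun (.mk Φ t (s, p + d)) n := fun n s p =>
    act_zpow_mk (φ := fun u => f.toFun u n) (fun t u v h => f.map_edge t u v n h) t s p d
  rw [← hz, ← hz, hf']

/-- Points on different lines of the same direction can be shifted. -/
theorem canShift_of_lines_ne {J T : Type} {Φ : Fin 2 → J → T × ℤ} (hΦ : ∀ t, IsSidon (Φ t))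
    (hlin : ∀ j j', (Φ 0 j).1 = (Φ 0 j').1 → (Φ 1 j).1 = (Φ 1 j').1 → j = j') (j₀ : J) (t : Fin 2)
    {s s' : T} (hs : s ≠ s') (p p' : ℤ) :
    CanShift (rulerEdge Φ) (junctionVertex Φ j₀) (.mk Φ t (s, p)) (.mk Φ t (s', p')) := by
  obtain ⟨t', htt⟩ : ∃ t' : Fin 2, t ≠ t' := ⟨t + 1, by omega⟩
  -- If the superposition makes no junctions meet, the other direction is left alone. If it makes
  -- `j₁` and `j₂` meet, one may slide to this pair, and the lines crossing there must be treated as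
  -- well.
  by_cases hj : ∃ j₁ j₂, (Φ t j₁).1 = s ∧ (Φ t j₂).1 = s' ∧ (Φ t j₁).2 - p = (Φ t j₂).2 - p'
  · obtain ⟨j₁, j₂, rfl, rfl, hd⟩ := hj
    suffices h : CanShift (rulerEdge Φ) (junctionVertex Φ j₀) (.mk Φ t (Φ t j₁))
        (.mk Φ t (Φ t j₂)) by
      have := CanShift.slide (s := (Φ t j₁).1) (p := (Φ t j₁).2) (s' := (Φ t j₂).1)
        (p' := (Φ t j₂).2) h (p - (Φ t j₁).2)
      rwa [show (Φ t j₁).2 + (p - (Φ t j₁).2) = p by ring,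
        show (Φ t j₂).2 + (p - (Φ t j₁).2) = p' by linarith] at this
    -- A common crossing line winds up to a helix. Different crossing lines are superposed too, with
    -- `j₁` and `j₂` again their only collision.
    by_cases hB : (Φ t' j₁).1 = (Φ t' j₂).1
    · rw [RulerVertex.mk_junction Φ t t', RulerVertex.mk_junction Φ t t',
        ← Prod.mk.eta (p := Φ t' j₁), ← Prod.mk.eta (p := Φ t' j₂), ← hB]
      refine canShift_of_same_line hΦ hlin j₀ t' _ fun h2 => hs ?_
      rw [(hΦ t').eq hB h2]
    · refine canShift_of_place htt
        (mergeLines (Φ t j₁).1 (Φ t j₂).1 ((Φ t j₁).2 - (Φ t j₂).2))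
        (mergeLines (Φ t' j₁).1 (Φ t' j₂).1 ((Φ t' j₁).2 - (Φ t' j₂).2))
        (fun j n j' n' => ?_) j₀ (fun n n' h => ?_) _ _ (fun n => ?_)
      · rw [place_mergeLines_junction_iff (hΦ t) hs, place_mergeLines_junction_iff (hΦ t') hB]
      · rw [place_mergeLines_eq_iff hs] at h
        grind
      · rw [place_mergeLines_eq_iff hs]
        exact Or.inr (Or.inr ⟨rfl, rfl, rfl, by ring⟩)
  · refine canShift_of_place htt (mergeLines s s' (p - p')) (fun r n => ((r, n), 0))
      (fun j n j' n' => ?_) j₀ (fun n n' h => ?_) _ _ (fun n => ?_)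
    · rw [place_mergeLines_eq_iff hs]
      have h1 : place (fun r n => (((r, n) : T × ℤ), (0 : ℤ))) (Φ t' j) n =
          place (fun r n => ((r, n), 0)) (Φ t' j') n' ↔ j = j' ∧ n = n' := by
        rw [← (hΦ t').injective.eq_iff, Prod.ext_iff]
        simp [place, Prod.ext_iff]
        tauto
      rw [h1, (hΦ t).injective.eq_iff]
      refine ⟨?_, Or.inl⟩
      rintro (h | ⟨h2, h3, -, h4⟩ | ⟨h2, h3, -, h4⟩)
      · exact h
      · exact absurd ⟨j, j', h2, h3, by linarith⟩ hj
      · exact absurd ⟨j', j, h3, h2, by linarith⟩ hj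
    · rw [place_mergeLines_eq_iff hs] at h
      grind
    · rw [place_mergeLines_eq_iff hs]
      exact Or.inr (Or.inr ⟨rfl, rfl, rfl, by ring⟩)

theorem IsSidon.sameKernel {J T : Type} {Φ : Fin 2 → J → T × ℤ} (hΦ : ∀ t, IsSidon (Φ t)) :
    SameKernel Φ := fun t t' j j' h => by rw [(hΦ t).injective h]

/-- In a graph of lines with distinct differences all pairs of distinct vertices can be shifted. -/
theorem canShift_of_isSidon {J T : Type} {Φ : Fin 2 → J → T × ℤ} (hΦ : ∀ t, IsSidon (Φ t))
    (hlin : ∀ j j', (Φ 0 j).1 = (Φ 0 j').1 → (Φ 1 j).1 = (Φ 1 j').1 → j = j') (j₀ : J)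
    (x y : RulerVertex Φ) (hxy : x ≠ y) : CanShift (rulerEdge Φ) (junctionVertex Φ j₀) x y := by
  by_cases h : ∃ t u v, x = .mk Φ t u ∧ y = .mk Φ t v
  · obtain ⟨t, ⟨s, p⟩, ⟨s', p'⟩, rfl, rfl⟩ := h
    by_cases hs : s = s'
    · subst hs
      exact canShift_of_same_line hΦ hlin j₀ t s fun hp => hxy (by rw [hp])
    · exact canShift_of_lines_ne hΦ hlin j₀ t hs p p'
  · refine canShift_of_not_incident (IsSidon.sameKernel hΦ).isFolded _ x y hxy fun t ht => h ?_
    have hinc : ∀ z : RulerVertex Φ, (∃ u, rulerEdge Φ t z u ∨ rulerEdge Φ t u z) →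
        ∃ u, z = .mk Φ t u := by
      rintro z ⟨u, ⟨s, p, h1, -⟩ | ⟨s, p, -, h1⟩⟩
      · exact ⟨_, h1⟩
      · exact ⟨_, h1⟩
    obtain ⟨u, hu⟩ := hinc x ht.1
    obtain ⟨v, hv⟩ := hinc y ht.2
    exact ⟨t, u, v, hu, hv⟩

/-! ### From distinct exponents to distinct differences. -/

/-- The marked points on the lines of one direction. -/
inductive RulerPoint (m r : ℕ) : Type
  | base : RulerPoint m r
  | tip (i : Fin m) : RulerPoint m r
  | left (i : Fin m) (j : Fin r) : RulerPoint m r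
  | right (i : Fin m) (j : Fin r) : RulerPoint m r

/-- The positions of the marked points: all tips lie on the line of the base point. -/
def RulerPoint.position {m r : ℕ} (c : Fin m → ℤ) (e : Fin m → Fin r → ℤ) :
    RulerPoint m r → Option (Fin m × Fin r) × ℤ
  | base => (none, 0)
  | tip i => (none, c i)
  | left i j => (some (i, j), e i j)
  | right i j => (some (i, j), 0)

/-- The absolute values of the exponents and of the differences of the exponents with index `j₀`. -/
def exponentValue {m s : ℕ} (e : Fin m → Fin s → ℤ) (j₀ : Fin s) :
    (Fin m × Fin s) ⊕ {p : Fin m × Fin m // p.1 < p.2} → ℤ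
  | .inl p => |e p.1 p.2|
  | .inr p => |e p.1.1 j₀ - e p.1.2 j₀|

theorem range_exponentValue {m s : ℕ} (e : Fin m → Fin s → ℤ) (j₀ : Fin s) :
    Set.range (exponentValue e j₀) = exponentSet e j₀ := by
  ext x
  simp only [Set.mem_range, exponentSet, Set.mem_union, Set.mem_ofPred_eq, Sum.exists, Prod.exists,
    Subtype.exists, exponentValue]
  constructor
  · rintro (⟨i, j, rfl⟩ | ⟨i, j, h, rfl⟩)
    · exact Or.inl ⟨i, j, rfl⟩
    · exact Or.inr ⟨i, j, h, rfl⟩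
  · rintro (⟨i, j, rfl⟩ | ⟨i, j, h, rfl⟩)
    · exact Or.inl ⟨i, j, rfl⟩
    · exact Or.inr ⟨i, j, h, rfl⟩

theorem card_pairs_le (m : ℕ) : Nat.card {p : Fin m × Fin m // p.1 < p.2} ≤ m.choose 2 := by
  have h : Nat.card ((i : Fin m) × Fin i) = m.choose 2 := by
    rw [Nat.card_eq_fintype_card, Fintype.card_sigma]
    simp only [Fintype.card_fin]
    rw [Fin.sum_univ_eq_sum_range (fun i => i) m, Finset.sum_range_id, Nat.choose_two_right]
  rw [← h]
  refine Nat.card_le_card_of_injective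
    (fun p => (⟨p.1.2, ⟨p.1.1, p.2⟩⟩ : (i : Fin m) × Fin i)) ?_
  rintro ⟨⟨a, b⟩, hab⟩ ⟨⟨c, d⟩, hcd⟩ h
  simp only [Sigma.mk.injEq] at h
  obtain ⟨rfl, h⟩ := h
  simp only [heq_eq_eq, Fin.mk.injEq] at h
  simp [Fin.ext h]

/-- The index type has at most `s * m + m.choose 2` elements, so attaining this many values leaves
no room for a coincidence. -/
theorem exponentValue_injective {m s : ℕ} {e : Fin m → Fin s → ℤ} {j₀ : Fin s}
    (h : (exponentSet e j₀).ncard = s * m + m.choose 2) :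
    Function.Injective (exponentValue e j₀) := by
  rw [← Set.injOn_univ]
  refine Set.injOn_of_ncard_image_eq (le_antisymm (Set.ncard_image_le Set.finite_univ) ?_)
    Set.finite_univ
  rw [Set.image_univ, range_exponentValue, h, Set.ncard_univ, Nat.card_sum, Nat.card_prod]
  have := card_pairs_le m
  simp only [Nat.card_eq_fintype_card, Fintype.card_fin] at this ⊢
  rw [mul_comm m s]
  omega

/-- The points `p` and `q` of a common line form the pair with the difference of the given index. -/
def IsGap {m r : ℕ} (j₀ : Fin (r + 1)) (p q : RulerPoint m r) :
    (Fin m × Fin (r + 1)) ⊕ {p : Fin m × Fin m // p.1 < p.2} → Prop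
  | .inl a => (a.2 = j₀ ∧ p = .base ∧ q = .tip a.1) ∨
      ∃ j, a.2 = j₀.succAbove j ∧ p = .right a.1 j ∧ q = .left a.1 j
  | .inr a => p = .tip a.1.1 ∧ q = .tip a.1.2

theorem IsGap.unique {m r : ℕ} {j₀ : Fin (r + 1)} {p q p' q' : RulerPoint m r}
    {a : (Fin m × Fin (r + 1)) ⊕ {p : Fin m × Fin m // p.1 < p.2}} (h : IsGap j₀ p q a)
    (h' : IsGap j₀ p' q' a) : p = p' ∧ q = q' := by
  rcases a with ⟨i, j⟩ | a
  · rcases h with ⟨rfl, rfl, rfl⟩ | ⟨j, rfl, rfl, rfl⟩ <;>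
      rcases h' with ⟨h1, rfl, rfl⟩ | ⟨j', h1, rfl, rfl⟩
    · exact ⟨rfl, rfl⟩
    · exact absurd h1.symm (Fin.succAbove_ne _ _)
    · exact absurd h1 (Fin.succAbove_ne _ _)
    · rw [Fin.succAbove_right_injective h1]
      exact ⟨rfl, rfl⟩
  · obtain ⟨rfl, rfl⟩ := h
    obtain ⟨rfl, rfl⟩ := h'
    exact ⟨rfl, rfl⟩

theorem exists_isGap {m r : ℕ} (j₀ : Fin (r + 1)) (c : Fin m → ℤ) (e : Fin m → Fin r → ℤ)
    {p q : RulerPoint m r} (hpq : (p.position c e).1 = (q.position c e).1) (hne : p ≠ q) :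
    ∃ a, IsGap j₀ p q a ∨ IsGap j₀ q p a := by
  rcases p with _ | i | ⟨i, j⟩ | ⟨i, j⟩ <;> rcases q with _ | i' | ⟨i', j'⟩ | ⟨i', j'⟩ <;>
    simp only [RulerPoint.position, reduceCtorEq, Option.some.injEq, Prod.mk.injEq] at hpq
  · exact absurd rfl hne
  · exact ⟨.inl (i', j₀), Or.inl (Or.inl ⟨rfl, rfl, rfl⟩)⟩
  · exact ⟨.inl (i, j₀), Or.inr (Or.inl ⟨rfl, rfl, rfl⟩)⟩
  · have hii : i ≠ i' := fun h => hne (by rw [h])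
    rcases lt_or_gt_of_ne hii with h | h
    · exact ⟨.inr ⟨(i, i'), h⟩, Or.inl ⟨rfl, rfl⟩⟩
    · exact ⟨.inr ⟨(i', i), h⟩, Or.inr ⟨rfl, rfl⟩⟩
  · obtain ⟨rfl, rfl⟩ := hpq
    exact absurd rfl hne
  · obtain ⟨rfl, rfl⟩ := hpq
    exact ⟨.inl (i, j₀.succAbove j), Or.inr (Or.inr ⟨j, rfl, rfl, rfl⟩)⟩
  · obtain ⟨rfl, rfl⟩ := hpq
    exact ⟨.inl (i, j₀.succAbove j), Or.inl (Or.inr ⟨j, rfl, rfl, rfl⟩)⟩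
  · obtain ⟨rfl, rfl⟩ := hpq
    exact absurd rfl hne

/-- The pairs of points on common lines are indexed by the listed absolute values: base and tips
give the exponents at `j₀` and their differences, every other line gives one exponent. Hence the
absolute difference determines the unordered pair, and its sign the order. The sign `ε` allows the
tips on either side of the base. -/
theorem isSidon_position {m r : ℕ} {f : Fin m → Fin (r + 1) → ℤ} {j₀ : Fin (r + 1)}
    (hf : ∀ i j, f i j ≠ 0) (hinj : Function.Injective (exponentValue f j₀)) {c : Fin m → ℤ}
    (hc : ∃ ε : ℤ, |ε| = 1 ∧ ∀ i, c i = ε * f i j₀) :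
    IsSidon (RulerPoint.position c fun i j => f i (j₀.succAbove j)) := by
  obtain ⟨ε, hε, hc⟩ := hc
  set pos : RulerPoint m r → Option (Fin m × Fin r) × ℤ :=
    RulerPoint.position c fun i j => f i (j₀.succAbove j) with hpos
  have hval : ∀ {a p q}, IsGap j₀ p q a → |(pos q).2 - (pos p).2| = exponentValue f j₀ a := by
    rintro (⟨i, j⟩ | a) p q h
    · rcases h with ⟨rfl, rfl, rfl⟩ | ⟨j, rfl, rfl, rfl⟩
      · simp [hpos, RulerPoint.position, exponentValue, hc, abs_mul, hε]
      · simp [hpos, RulerPoint.position, exponentValue]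
    · obtain ⟨rfl, rfl⟩ := h
      simp only [hpos, RulerPoint.position, exponentValue, hc]
      rw [← mul_sub, abs_mul, hε, one_mul, abs_sub_comm]
  have hval0 : ∀ a, exponentValue f j₀ a ≠ 0 := by
    rintro (⟨i, j⟩ | ⟨⟨i, i'⟩, h⟩) h0
    · exact hf i j (abs_eq_zero.1 h0)
    · have h1 : f i j₀ = f i' j₀ := sub_eq_zero.1 (abs_eq_zero.1 h0)
      have h2 := @hinj (.inl (i, j₀)) (.inl (i', j₀)) (by simp [exponentValue, h1])
      simp only [Sum.inl.injEq, Prod.mk.injEq, and_true] at h2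
      exact h.ne h2
  intro p q p' q' h h' hd hne
  obtain ⟨a, ha⟩ := exists_isGap j₀ _ _ h hne
  have hav : |(pos q).2 - (pos p).2| = exponentValue f j₀ a := by
    rcases ha with ha | ha
    · exact hval ha
    · rw [abs_sub_comm]
      exact hval ha
  have hne' : p' ≠ q' := by
    rintro rfl
    rw [hd, sub_self, abs_zero] at hav
    exact hval0 a hav.symm
  obtain ⟨b, hb⟩ := exists_isGap j₀ _ _ h' hne'
  have hbv : |(pos q').2 - (pos p').2| = exponentValue f j₀ b := by
    rcases hb with hb | hb
    · exact hval hb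
    · rw [abs_sub_comm]
      exact hval hb
  obtain rfl : a = b := hinj (by rw [← hav, ← hbv, hd])
  have hswap : ¬ (p = q' ∧ q = p') := by
    rintro ⟨rfl, rfl⟩
    have h0 : (pos q).2 - (pos p).2 = 0 := by linarith
    rw [h0, abs_zero] at hav
    exact hval0 a hav.symm
  rcases ha with ha | ha <;> rcases hb with hb | hb
  · exact ha.unique hb
  · exact absurd (ha.unique hb) hswap
  · exact absurd (ha.unique hb).symm hswap
  · exact (ha.unique hb).symm

/-! ### The graph of the generators. -/

/-- The vertices, apart from subdivision points, of the graph formed by the loops `α₁, …, αₘ`. -/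
inductive Junction (m r : ℕ) : Type
  | base : Junction m r
  | mid (i : Fin m) (j : Fin (r + 1)) : Junction m r
  | joint (i : Fin m) (j : Fin r) : Junction m r

/-- The place of a junction on the lines of direction `0`. -/
def Junction.point₀ {m r : ℕ} : Junction m r → RulerPoint m r
  | base => .base
  | mid i j => Fin.cases (.tip i) (fun j => .right i j) j
  | joint i j => .left i j

/-- The place of a junction on the lines of direction `1`. -/
def Junction.point₁ {m r : ℕ} : Junction m r → RulerPoint m r
  | base => .base
  | mid i j => Fin.lastCases (.tip i) (fun j => .left i j) j
  | joint i j => .right i j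

theorem Junction.point₀_injective {m r : ℕ} :
    Function.Injective (Junction.point₀ : Junction m r → RulerPoint m r) := by
  rintro (_ | ⟨i, j⟩ | ⟨i, j⟩) (_ | ⟨i', j'⟩ | ⟨i', j'⟩) h <;>
    first
    | (cases j using Fin.cases <;> cases j' using Fin.cases <;> simp_all [point₀])
    | (cases j using Fin.cases <;> simp_all [point₀])
    | (cases j' using Fin.cases <;> simp_all [point₀])
    | simp_all [point₀]

theorem Junction.point₁_injective {m r : ℕ} :
    Function.Injective (Junction.point₁ : Junction m r → RulerPoint m r) := by
  rintro (_ | ⟨i, j⟩ | ⟨i, j⟩) (_ | ⟨i', j'⟩ | ⟨i', j'⟩) h <;>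
    first
    | (cases j using Fin.lastCases <;> cases j' using Fin.lastCases <;> simp_all [point₁])
    | (cases j using Fin.lastCases <;> simp_all [point₁])
    | (cases j' using Fin.lastCases <;> simp_all [point₁])
    | simp_all [point₁]

/-- The positions of the junctions on the lines of both directions. -/
def junctionPosition {m r : ℕ} (k : Fin m → Fin (r + 1) → Fin 2 → ℤ) :
    Fin 2 → Junction m r → Option (Fin m × Fin r) × ℤ :=
  ![fun p => p.point₀.position (fun i => -k i 0 0) fun i j => k i j.succ 0,
    fun p => p.point₁.position (fun i => k i (Fin.last r) 1) fun i j => k i j.castSucc 1]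

theorem IsSidon.comp {I J T : Type} {φ : J → T × ℤ} (h : IsSidon φ) {g : I → J}
    (hg : Function.Injective g) : IsSidon (φ ∘ g) := fun _ _ _ _ h1 h2 h3 h4 =>
  (h _ _ _ _ h1 h2 h3 (hg.ne h4)).imp (fun h => hg h) fun h => hg h

theorem isSidon_junctionPosition {m r : ℕ} {k : Fin m → Fin (r + 1) → Fin 2 → ℤ}
    (hk : ∀ i j t, k i j t ≠ 0)
    (h₀ : Function.Injective (exponentValue (fun i j => k i j 0) 0))
    (h₁ : Function.Injective (exponentValue (fun i j => k i j 1) (Fin.last r))) (t : Fin 2) :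
    IsSidon (junctionPosition k t) := by
  fin_cases t
  · have := isSidon_position (fun i j => hk i j 0) h₀ (c := fun i => -k i 0 0)
      ⟨-1, by simp, fun i => by simp⟩
    simp only [Fin.succAbove_zero] at this
    exact this.comp Junction.point₀_injective
  · have := isSidon_position (fun i j => hk i j 1) h₁ (c := fun i => k i (Fin.last r) 1)
      ⟨1, by simp, fun i => by simp⟩
    simp only [Fin.succAbove_last] at this
    exact this.comp Junction.point₁_injective

theorem line_one_mid {m r : ℕ} (k : Fin m → Fin (r + 1) → Fin 2 → ℤ) (i : Fin m) (j : Fin r) :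
    (junctionPosition k 1 (.mid i j.castSucc)).1 = some (i, j) := by
  simp [junctionPosition, Junction.point₁, RulerPoint.position]

theorem line_zero_mid {m r : ℕ} (k : Fin m → Fin (r + 1) → Fin 2 → ℤ) (i : Fin m) (j : Fin r) :
    (junctionPosition k 0 (.mid i j.succ)).1 = some (i, j) := by
  simp [junctionPosition, Junction.point₀, RulerPoint.position]

/-- In each loop, `joint j` lies on the lines with index `j` in both directions, while `mid j` lies
on the `a`-line `j - 1` and the `b`-line `j`, the line of the base replacing an index out of range.
For `r = 0` both lines of `mid 0` would be those of the base. -/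
theorem eq_of_common_lines {m r : ℕ} (hr : 0 < r) {k : Fin m → Fin (r + 1) → Fin 2 → ℤ}
    (p q : Junction m r) (h₀ : (junctionPosition k 0 p).1 = (junctionPosition k 0 q).1)
    (h₁ : (junctionPosition k 1 p).1 = (junctionPosition k 1 q).1) : p = q := by
  have hbase : ∀ t, (junctionPosition k t .base).1 = none := fun t => by fin_cases t <;> rfl
  have hjoint : ∀ t i j, (junctionPosition k t (.joint i j)).1 = some (i, j) := fun t i j => by
    fin_cases t <;> rfl
  have hzero : ∀ i, (junctionPosition k 1 (.mid i 0)).1 = some (i, ⟨0, hr⟩) := fun i =>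
    line_one_mid k i ⟨0, hr⟩
  have hbm : ∀ i j, (junctionPosition k 0 (.mid i j)).1 = none →
      (junctionPosition k 1 (.mid i j)).1 ≠ none := by
    intro i j h
    cases j using Fin.cases with
    | zero => simp [hzero]
    | succ j => simp [line_zero_mid] at h
  have hmj : ∀ i j i' j', (junctionPosition k 0 (.mid i j)).1 = some (i', j') →
      (junctionPosition k 1 (.mid i j)).1 ≠ some (i', j') := by
    intro i j i' j' h h'
    cases j using Fin.lastCases with
    | last => simp [junctionPosition, Junction.point₁, RulerPoint.position] at h'
    | cast l =>
      rw [line_one_mid, Option.some.injEq, Prod.mk.injEq] at h'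
      obtain ⟨rfl, rfl⟩ := h'
      generalize hl : l.castSucc = z at h
      cases z using Fin.cases with
      | zero => simp [junctionPosition, Junction.point₀, RulerPoint.position] at h
      | succ z =>
        rw [line_zero_mid, Option.some.injEq, Prod.mk.injEq] at h
        rw [h.2] at hl
        exact absurd hl l.castSucc_lt_succ.ne
  rcases p with _ | ⟨i, j⟩ | ⟨i, j⟩ <;> rcases q with _ | ⟨i', j'⟩ | ⟨i', j'⟩
  · rfl
  · exact absurd (h₁.symm.trans (hbase 1)) (hbm i' j' (h₀.symm.trans (hbase 0)))
  · simp [hbase, hjoint] at h₀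
  · exact absurd (h₁.trans (hbase 1)) (hbm i j (h₀.trans (hbase 0)))
  · cases j using Fin.cases with
    | zero =>
      cases j' using Fin.cases with
      | zero =>
        rw [hzero, hzero, Option.some.injEq, Prod.mk.injEq] at h₁
        rw [h₁.1]
      | succ j' =>
        rw [line_zero_mid] at h₀
        simp [junctionPosition, Junction.point₀, RulerPoint.position] at h₀
    | succ j =>
      cases j' using Fin.cases with
      | zero =>
        rw [line_zero_mid] at h₀
        simp [junctionPosition, Junction.point₀, RulerPoint.position] at h₀
      | succ j' =>
        rw [line_zero_mid, line_zero_mid, Option.some.injEq, Prod.mk.injEq] at h₀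
        rw [h₀.1, h₀.2]
  · exact absurd (h₁.trans (hjoint 1 _ _)) (hmj _ _ _ _ (h₀.trans (hjoint 0 _ _)))
  · simp [hbase, hjoint] at h₀
  · exact absurd (h₁.symm.trans (hjoint 1 _ _)) (hmj _ _ _ _ (h₀.symm.trans (hjoint 0 _ _)))
  · rw [hjoint, hjoint, Option.some.injEq, Prod.mk.injEq] at h₀
    rw [h₀.1, h₀.2]

theorem alphaWord_eq_partialProd {m r : ℕ} (k : Fin m → Fin (r + 1) → Fin 2 → ℤ) (i : Fin m) :
    alphaWord k i = Fin.partialProd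
      (fun j : Fin (r + 1) => FreeGroup.of 0 ^ k i j 0 * FreeGroup.of 1 ^ k i j 1)
      (Fin.last r).succ := by
  rw [Fin.succ_last, Fin.partialProd, Fin.val_last, List.take_of_length_le (by simp), alphaWord]

/-- The ends of the syllables of `αᵢ`. -/
def Junction.corner {m r : ℕ} (i : Fin m) (j : Fin (r + 2)) : Junction m r :=
  Fin.cases .base (fun j => Fin.lastCases .base (fun j => .joint i j) j) j

theorem junctionPosition_corner_castSucc {m r : ℕ} (k : Fin m → Fin (r + 1) → Fin 2 → ℤ) (i : Fin m)
    (j : Fin (r + 1)) : junctionPosition k 0 (.corner i j.castSucc) =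
      ((junctionPosition k 0 (.mid i j)).1, (junctionPosition k 0 (.mid i j)).2 + k i j 0) := by
  cases j using Fin.cases with
  | zero => simp [junctionPosition, Junction.corner, Junction.point₀, RulerPoint.position]
  | succ j =>
    simp [junctionPosition, Junction.corner, Junction.point₀, RulerPoint.position]

theorem junctionPosition_mid {m r : ℕ} (k : Fin m → Fin (r + 1) → Fin 2 → ℤ) (i : Fin m)
    (j : Fin (r + 1)) : junctionPosition k 1 (.mid i j) =
      ((junctionPosition k 1 (.corner i j.succ)).1,
        (junctionPosition k 1 (.corner i j.succ)).2 + k i j 1) := by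
  cases j using Fin.lastCases with
  | last =>
    rw [Junction.corner, Fin.cases_succ, Fin.lastCases_last]
    simp [junctionPosition, Junction.point₁, RulerPoint.position]
  | cast j => simp [junctionPosition, Junction.corner, Junction.point₁, RulerPoint.position]

/-- The word `αᵢ` fixes the image of the base point under each compatible map. -/
theorem act_alphaWord {m r : ℕ} (k : Fin m → Fin (r + 1) → Fin 2 → ℤ) {Y : Type}
    {ρ : FreeGroup (Fin 2) →* Equiv.Perm Y} {φ : RulerVertex (junctionPosition k) → Y}
    (h : ∀ t u v, rulerEdge (junctionPosition k) t u v → ρ (FreeGroup.of t) (φ u) = φ v)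
    (i : Fin m) : ρ (alphaWord k i) (φ (junctionVertex _ .base)) = φ (junctionVertex _ .base) := by
  -- Products act from the right: the `b`-syllable leads from the later corner to the midpoint, then
  -- the `a`-syllable to the earlier corner.
  have hstep : ∀ j : Fin (r + 1), ρ (FreeGroup.of 0 ^ k i j 0 * FreeGroup.of 1 ^ k i j 1)
      (φ (junctionVertex _ (.corner i j.succ))) = φ (junctionVertex _ (.corner i j.castSucc)) := by
    intro j
    rw [map_mul, Equiv.Perm.mul_apply, ← mk_eq_junctionVertex _ 1, ← Prod.mk.eta
      (p := junctionPosition k 1 _), act_zpow_mk h, ← junctionPosition_mid, mk_eq_junctionVertex,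
      ← mk_eq_junctionVertex _ 0, ← Prod.mk.eta (p := junctionPosition k 0 (.mid i j)),
      act_zpow_mk h, ← junctionPosition_corner_castSucc, mk_eq_junctionVertex]
  have hall : ∀ j : Fin (r + 2), ρ (Fin.partialProd
      (fun j : Fin (r + 1) => FreeGroup.of 0 ^ k i j 0 * FreeGroup.of 1 ^ k i j 1) j)
      (φ (junctionVertex _ (.corner i j))) = φ (junctionVertex _ .base) := by
    intro j
    induction j using Fin.induction with
    | zero => simp [Junction.corner]
    | succ j ih => rw [Fin.partialProd_succ, map_mul, Equiv.Perm.mul_apply, hstep, ih]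
  have := hall (Fin.last r).succ
  rwa [← alphaWord_eq_partialProd, Junction.corner, Fin.cases_succ, Fin.lastCases_last] at this

/-! ### Closed paths at the base represent elements of the subgroup. -/

/-- The coset represented by a junction. -/
def Junction.coset {m r : ℕ} (k : Fin m → Fin (r + 1) → Fin 2 → ℤ) :
    Junction m r → FreeGroup (Fin 2) ⧸ subgroupC k
  | base => ((1 : FreeGroup (Fin 2)) : _ ⧸ subgroupC k)
  | mid i j => ((FreeGroup.of 0 ^ (-k i j 0) * (Fin.partialProd
      (fun j : Fin (r + 1) => FreeGroup.of 0 ^ k i j 0 * FreeGroup.of 1 ^ k i j 1)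
      j.castSucc)⁻¹ : FreeGroup (Fin 2)) : _ ⧸ subgroupC k)
  | joint i j => (((Fin.partialProd
      (fun j : Fin (r + 1) => FreeGroup.of 0 ^ k i j 0 * FreeGroup.of 1 ^ k i j 1)
      j.castSucc.succ)⁻¹ : FreeGroup (Fin 2)) : _ ⧸ subgroupC k)

/-- The coset represented by the origin of a line. -/
def originCoset {m r : ℕ} (k : Fin m → Fin (r + 1) → Fin 2 → ℤ) :
    Fin 2 → Option (Fin m × Fin r) → FreeGroup (Fin 2) ⧸ subgroupC k :=
  ![fun s => s.elim (Junction.base.coset k) fun p => (Junction.mid p.1 p.2.succ).coset k,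
    fun s => s.elim (Junction.base.coset k) fun p => (Junction.joint p.1 p.2).coset k]

theorem zpow_smul_originCoset {m r : ℕ} (k : Fin m → Fin (r + 1) → Fin 2 → ℤ) (t : Fin 2)
    (p : Junction m r) : FreeGroup.of t ^ (junctionPosition k t p).2 •
      originCoset k t (junctionPosition k t p).1 = p.coset k := by
  fin_cases t
  · rcases p with _ | ⟨i, j⟩ | ⟨i, j⟩
    · simp [junctionPosition, originCoset, Junction.point₀, RulerPoint.position]
    · cases j using Fin.cases <;>
      simp [junctionPosition, originCoset, Junction.point₀, RulerPoint.position, Junction.coset]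
    · simp [junctionPosition, originCoset, Junction.point₀, RulerPoint.position, Junction.coset]
  · rcases p with _ | ⟨i, j⟩ | ⟨i, j⟩
    · simp [junctionPosition, originCoset, Junction.point₁, RulerPoint.position]
    · cases j using Fin.lastCases with
      | last =>
        -- Here the loop closes up: the two ways from the base to the last midpoint differ by `αᵢ`.
        have h : (alphaWord k i)⁻¹ ∈ subgroupC k :=
          inv_mem (Subgroup.subset_closure (Set.mem_range_self i))
        rw [alphaWord_eq_partialProd, Fin.partialProd_succ] at h
        simp only [junctionPosition, originCoset, Junction.point₁, RulerPoint.position,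
          Junction.coset, Fin.mk_one, Matrix.cons_val_one, Matrix.cons_val_fin_one,
          Fin.lastCases_last, Option.elim_none, MulAction.Quotient.smul_coe, smul_eq_mul, mul_one]
        rw [QuotientGroup.eq]
        simpa [mul_assoc] using h
      | cast j =>
        simp [junctionPosition, originCoset, Junction.point₁, RulerPoint.position, Junction.coset,
          Fin.partialProd_succ, mul_assoc]
    · simp [junctionPosition, originCoset, Junction.point₁, RulerPoint.position]

/-- Mapping the graph to the Schreier graph of `C` turns a closed path at the base with label `g`
into `g • C = C`, that is, `g ∈ C`. -/
theorem exists_cosetMap {m r : ℕ} (k : Fin m → Fin (r + 1) → Fin 2 → ℤ) :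
    ∃ φ : RulerVertex (junctionPosition k) → FreeGroup (Fin 2) ⧸ subgroupC k,
      (∀ t u v, rulerEdge (junctionPosition k) t u v →
        MulAction.toPermHom _ _ (FreeGroup.of t) (φ u) = φ v) ∧
      φ (junctionVertex _ .base) = ((1 : FreeGroup (Fin 2)) : _ ⧸ subgroupC k) := by
  refine ⟨Quot.lift (fun p => FreeGroup.of p.1 ^ p.2.2 • originCoset k p.1 p.2.1) ?_, ?_, ?_⟩
  · rintro p p' (rfl | ⟨q, -, h1, h2⟩)
    · rfl
    · rw [← h1, ← h2, zpow_smul_originCoset, zpow_smul_originCoset]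
  · rintro t _ _ ⟨s, p, rfl, rfl⟩
    change FreeGroup.of t • FreeGroup.of t ^ p • originCoset k t s =
      FreeGroup.of t ^ (p + 1) • originCoset k t s
    rw [smul_smul, ← zpow_one_add, add_comm (1 : ℤ)]
  · exact zpow_smul_originCoset k 0 .base

/-! ### Conclusion. -/

theorem theoremT (m s : ℕ) (hs : 10 ≤ s) (k : Fin m → Fin s → Fin 2 → ℤ)
    (hk : ∀ i j t, k i j t ≠ 0)
    (hA : DistinctExponents (lt_of_lt_of_le (by norm_num) hs) k) :
    IsRelativelyTorsionFree (subgroupC k) := by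
  obtain ⟨r, rfl⟩ : ∃ r, s = r + 1 := ⟨s - 1, by omega⟩
  have hΦ := isSidon_junctionPosition hk (exponentValue_injective hA.1)
    (exponentValue_injective hA.2)
  have hC : ∀ {Y : Type} (f : LevelMap (rulerEdge (junctionPosition k)) Y) (n : ℤ),
      ∀ h ∈ subgroupC k, f.act h (f.toFun (junctionVertex _ .base) n) =
        f.toFun (junctionVertex _ .base) n := by
    intro Y f n h hh
    induction hh using Subgroup.closure_induction with
    | mem x hx =>
      obtain ⟨i, rfl⟩ := hx
      exact act_alphaWord k (φ := fun u => f.toFun u n) (fun t u v h => f.map_edge t u v n h) i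
    | one => simp
    | mul x y _ _ hx hy => rw [map_mul, Equiv.Perm.mul_apply, hy, hx]
    | inv x _ hx => rw [map_inv, Equiv.Perm.inv_eq_iff_eq, hx]
  intro g hg n h hn hh
  rcases leadsTo_or_exists_levelMap (IsSidon.sameKernel hΦ).isFolded (junctionVertex _ .base)
    (canShift_of_isSidon hΦ (eq_of_common_lines (by omega)) .base) g with
    ⟨L, rfl, hL⟩ | ⟨Y, f, hf, hf'⟩
  · obtain ⟨φ, hφ, hφ1⟩ := exists_cosetMap k
    have h1 := act_mk_of_leadsTo hφ hL
    rw [hφ1] at h1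
    refine absurd ?_ hg
    have h2 : ((FreeGroup.mk L : FreeGroup (Fin 2)) : _ ⧸ subgroupC k) =
        ((1 : FreeGroup (Fin 2)) : _ ⧸ subgroupC k) := by
      simpa using h1
    simpa using QuotientGroup.eq.1 h2.symm
  -- Each factor `g * h i` raises the level of the base by exactly one.
  · have hprod : ∀ (n : ℕ) (h : Fin n → FreeGroup (Fin 2)), (∀ i, h i ∈ subgroupC k) → ∀ z : ℤ,
        f.act (List.ofFn fun i => g * h i).prod (f.toFun (junctionVertex _ .base) z) =
          f.toFun (junctionVertex _ .base) (z + n) := by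
      intro n
      induction n with
      | zero => simp
      | succ n ih =>
        intro h hh z
        rw [List.ofFn_succ, List.prod_cons, map_mul, Equiv.Perm.mul_apply, ih _ fun i => hh _,
          map_mul, Equiv.Perm.mul_apply, hC f _ _ (hh 0), hf']
        push_cast
        rw [add_assoc]
    intro h1
    have h2 := hprod n h hh 0
    rw [h1, map_one, Equiv.Perm.one_apply, zero_add] at h2
    have := hf h2
    omega
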